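/- For a complex matrix $M$, let $M^\dagger$ denote its Moore–Penrose inverse, $Q_M := M^\dagger M$, $M^*$ its conjugate transpose, and $\mathcal R(M)$, $\mathcal N(M)$ its range and null space. Let $A\in\mathbb C^{n\times n}$ have index $k\ge 1$, where the index is the smallest integer $k\ge 0$ with $\operatorname{rk}(A^k)=\operatorname{rk}(A^{k+1})$. Let $$A=U\begin{bmatrix}T&S\\0&N\end{bmatrix}U^*$$ be a core EP decomposition of $A$, i.e. $U\in\mathbb C^{n\times n}$ is unitary, $T\in\mathbb C^{t\times t}$ is nonsingular with $t=\operatorname{rk}(A^k)$, $S\in\mathbb C^{t\times(n-t)}$, and $N\in\mathbb C^{(n-t)\times(n-t)}$ is nilpotent of index $k$. Let $A^d$ be the Drazin inverse of $A$, that is, the unique $X$ with $XAX=X$, $AX=XA$, $XA^{k+1}=A^k$. Define the core EP inverse $A^{c}:=A^k(A^{k+1})^\dagger$, the WG (weak group) inverse $A^{w}:=(A^{c})^2A$, the dual DMP inverse $A^{\dagger,d}:=Q_AA^d$, and the dual WC inverse $A^{\dagger,w}:=Q_AA^{w}$. Then the following conditions are equivalent: (a) $A$ is a dual $k$-WC matrix,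 i.e. $A^kA^{\dagger,w}=A^{\dagger,w}A^k$; (b) $A^mA^{\dagger,w}=A^{\dagger,w}A^m$ for all positive integers $m$; (c) $A^mA^{\dagger,w}=A^{\dagger,w}A^m$ for some positive integer $m$; (d) $A^{\dagger,w}=A^d$; (e) $A$ is both a WG matrix, i.e. $AA^{w}=A^{w}A$, and a dual $k$-DMP matrix, i.e. $A^kA^{\dagger,d}=A^{\dagger,d}A^k$; (f) $\mathcal R(N)\subseteq\mathcal N(S)$ and $\mathcal N(N)\subseteq\mathcal N(S)$; (g) $SN+TS(I_{n-t}-Q_N)=0$. -/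

import Mathlib

open scoped Matrix

namespace GenInv

section MoorePenrose

variable {m n : Type*} [Fintype m] [Fintype n]

/-- `X` satisfies the four Penrose equations for `A`. -/
structure IsMoorePenrose (A : Matrix m n ℂ) (X : Matrix n m ℂ) : Prop where
  inner : A * X * A = A
  outer : X * A * X = X
  herm_left : (A * X)ᴴ = A * X
  herm_right : (X * A)ᴴ = X * A

open scoped ComplexOrder in
theorem exists_isMoorePenrose (A : Matrix m n ℂ) : ∃ X, IsMoorePenrose A X := by
  classical
  have key : ∀ H : Matrix n n ℂ, H.IsHermitian →
      ∃ G : Matrix n n ℂ, H * G * H = H ∧ G * H * G = G ∧ Gᴴ = G ∧ G * H = H * G := by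
    intro H hH
    let V : Matrix n n ℂ := (hH.eigenvectorUnitary : Matrix n n ℂ)
    let D : Matrix n n ℂ := Matrix.diagonal (fun i => ((hH.eigenvalues i : ℝ) : ℂ))
    let E : Matrix n n ℂ := Matrix.diagonal (fun i => (((hH.eigenvalues i)⁻¹ : ℝ) : ℂ))
    have hV : Vᴴ * V = 1 := Unitary.coe_star_mul_self hH.eigenvectorUnitary
    have hHD : H = V * D * Vᴴ := by
      have h := hH.spectral_theorem
      rw [Unitary.conjStarAlgAut_apply] at h
      exact h
    have hmul : ∀ P Q : Matrix n n ℂ, (V * P * Vᴴ) * (V * Q * Vᴴ) = V * (P * Q) * Vᴴ := by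
      intro P Q
      calc (V * P * Vᴴ) * (V * Q * Vᴴ) = V * P * (Vᴴ * V) * Q * Vᴴ := by
            simp only [Matrix.mul_assoc]
        _ = V * (P * Q) * Vᴴ := by rw [hV, Matrix.mul_one]; simp only [Matrix.mul_assoc]
    refine ⟨V * E * Vᴴ, ?_, ?_, ?_, ?_⟩
    · conv_lhs => rw [hHD]
      rw [hmul, hmul]
      conv_rhs => rw [hHD]
      congr 2
      simp only [D, E, Matrix.diagonal_mul_diagonal]
      congr 1
      funext i
      by_cases h : hH.eigenvalues i = 0
      · simp [h]
      · push_cast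
        field_simp
    · rw [hHD, hmul, hmul]
      congr 2
      simp only [D, E, Matrix.diagonal_mul_diagonal]
      congr 1
      funext i
      by_cases h : hH.eigenvalues i = 0
      · simp [h]
      · push_cast
        field_simp
    · simp only [Matrix.conjTranspose_mul, Matrix.conjTranspose_conjTranspose, E,
        Matrix.diagonal_conjTranspose, Matrix.mul_assoc]
      congr 3
      funext i
      simp
    · rw [hHD, hmul, hmul]
      congr 2
      simp only [D, E, Matrix.diagonal_mul_diagonal, mul_comm]
  have hH : (Aᴴ * A).IsHermitian := Matrix.isHermitian_conjTranspose_mul_self A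
  obtain ⟨G, h1, h2, h3, h4⟩ := key (Aᴴ * A) hH
  have hA : A * (G * (Aᴴ * A)) = A := by
    have h0 : (A * (G * (Aᴴ * A)) - A)ᴴ * (A * (G * (Aᴴ * A)) - A) = 0 := by
      have e : Aᴴ * (A * (G * (Aᴴ * A)) - A) = 0 := by
        rw [Matrix.mul_sub, sub_eq_zero]
        simpa only [Matrix.mul_assoc] using h1
      have e2 : (A * (G * (Aᴴ * A)) - A)ᴴ = (G * (Aᴴ * A) - 1)ᴴ * Aᴴ := by
        rw [← Matrix.conjTranspose_mul, Matrix.mul_sub, Matrix.mul_one]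
      rw [e2, Matrix.mul_assoc, e, Matrix.mul_zero]
    exact sub_eq_zero.mp (Matrix.conjTranspose_mul_self_eq_zero.mp h0)
  refine ⟨G * Aᴴ, ?_, ?_, ?_, ?_⟩
  · simpa only [Matrix.mul_assoc] using hA
  · calc G * Aᴴ * A * (G * Aᴴ) = (G * (Aᴴ * A) * G) * Aᴴ := by simp only [Matrix.mul_assoc]
      _ = G * Aᴴ := by rw [h2]
  · simp only [Matrix.conjTranspose_mul, Matrix.conjTranspose_conjTranspose, h3, Matrix.mul_assoc]
  · have : G * Aᴴ * A = G * (Aᴴ * A) := Matrix.mul_assoc _ _ _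
    rw [this, Matrix.conjTranspose_mul, h3, hH.eq, h4]

theorem IsMoorePenrose.unique {A : Matrix m n ℂ} {X Y : Matrix n m ℂ}
    (hX : IsMoorePenrose A X) (hY : IsMoorePenrose A Y) : X = Y := by
  have h1 : A * X = A * Y := by
    calc A * X = (A * X)ᴴ := hX.herm_left.symm
      _ = ((A * Y) * (A * X))ᴴ := by
          rw [← Matrix.mul_assoc (A * Y) A X, hY.inner]
      _ = (A * X) * (A * Y) := by
          rw [Matrix.conjTranspose_mul, hX.herm_left, hY.herm_left]
      _ = A * Y := by rw [← Matrix.mul_assoc (A * X) A Y, hX.inner]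
  have h2 : X * A = Y * A := by
    calc X * A = (X * A)ᴴ := hX.herm_right.symm
      _ = ((X * A) * (Y * A))ᴴ := by
          rw [Matrix.mul_assoc X A (Y * A), ← Matrix.mul_assoc A Y A, hY.inner]
      _ = (Y * A) * (X * A) := by
          rw [Matrix.conjTranspose_mul, hX.herm_right, hY.herm_right]
      _ = Y * A := by rw [Matrix.mul_assoc Y A (X * A), ← Matrix.mul_assoc A X A, hX.inner]
  calc X = X * A * X := hX.outer.symm
    _ = Y * A * Y := by rw [h2, Matrix.mul_assoc, h1, ← Matrix.mul_assoc]
    _ = Y := hY.outer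

/-- The Moore-Penrose inverse `A†`: the unique solution of the four Penrose equations. -/
noncomputable def mpInv (A : Matrix m n ℂ) : Matrix n m ℂ :=
  Classical.choose (exists_isMoorePenrose A)

theorem mpInv_spec (A : Matrix m n ℂ) : IsMoorePenrose A (mpInv A) :=
  Classical.choose_spec (exists_isMoorePenrose A)

/-- The orthogonal projector `Q_A = A† A` onto the range of `Aᴴ`. -/
noncomputable def projQ (A : Matrix m n ℂ) : Matrix n n ℂ := mpInv A * A

end MoorePenrose

section Square

variable {n : Type*} [Fintype n] [DecidableEq n]

theorem exists_rank_pow_eq (A : Matrix n n ℂ) : ∃ k : ℕ, (A ^ k).rank = (A ^ (k + 1)).rank := by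
  by_contra! h
  have hlt : ∀ k : ℕ, (A ^ (k + 1)).rank < (A ^ k).rank := fun k =>
    lt_of_le_of_ne (by rw [pow_succ]; exact Matrix.rank_mul_le_left _ _) (h k).symm
  have hb : ∀ k : ℕ, (A ^ k).rank + k ≤ (A ^ 0).rank := by
    intro k
    induction k with
    | zero => simp
    | succ k ih => have := hlt k; omega
  have := hb ((A ^ 0).rank + 1)
  omega

open Classical in
/-- The index of `A`: the smallest `k ≥ 0` with `rk (A ^ k) = rk (A ^ (k + 1))`. -/
noncomputable def ind (A : Matrix n n ℂ) : ℕ := Nat.find (exists_rank_pow_eq A)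

open Classical in
theorem ind_spec (A : Matrix n n ℂ) : (A ^ ind A).rank = (A ^ (ind A + 1)).rank :=
  Nat.find_spec (exists_rank_pow_eq A)

/-- `X` satisfies the three equations of the Drazin inverse of `A`, where `k` is the index. -/
structure IsDrazin (A X : Matrix n n ℂ) : Prop where
  outer : X * A * X = X
  comm : A * X = X * A
  pow : X * A ^ (ind A + 1) = A ^ ind A

theorem exists_isDrazin (A : Matrix n n ℂ) : ∃ X, IsDrazin A X := by
  have key : ∀ (B : Matrix n n ℂ) (k : ℕ), (B ^ k).rank = (B ^ (k + 1)).rank →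
      ∃ Y, B ^ k = B ^ (k + (k + 1)) * Y := by
    intro B k hk
    have hle : LinearMap.range (B ^ (k + 1)).mulVecLin ≤ LinearMap.range (B ^ k).mulVecLin := by
      rw [pow_succ, Matrix.mulVecLin_mul]
      exact LinearMap.range_comp_le_range _ _
    have heq : LinearMap.range (B ^ (k + 1)).mulVecLin = LinearMap.range (B ^ k).mulVecLin :=
      Submodule.eq_of_le_of_finrank_eq hle hk.symm
    have hcol : ∀ j : n, ∃ y : n → ℂ, (B ^ (k + 1)).mulVec y = (B ^ k).col j := by
      intro j
      have : (B ^ k).col j ∈ LinearMap.range (B ^ (k + 1)).mulVecLin := by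
        rw [heq]
        exact ⟨Pi.single j 1, by simp⟩
      exact this
    choose y hy using hcol
    have h1 : B ^ k = B ^ (k + 1) * Matrix.of (fun i j => y j i) := by
      ext i j
      exact (congrFun (hy j) i).symm
    have h2 : ∀ j : ℕ, ∃ Y, B ^ k = B ^ (k + j) * Y := by
      intro j
      induction j with
      | zero => exact ⟨1, by simp⟩
      | succ j ih =>
        obtain ⟨Y, hY⟩ := ih
        refine ⟨Matrix.of (fun i j => y j i) * Y, ?_⟩
        calc B ^ k = B ^ j * B ^ k * Y := by rw [← pow_add, add_comm j k]; exact hY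
          _ = B ^ j * (B ^ (k + 1) * Matrix.of (fun i j => y j i)) * Y := by rw [← h1]
          _ = B ^ (k + (j + 1)) * (Matrix.of (fun i j => y j i) * Y) := by
              rw [show k + (j + 1) = j + (k + 1) by omega, pow_add B j (k + 1)]
              simp only [Matrix.mul_assoc]
    exact h2 (k + 1)
  set k := ind A with hkdef
  obtain ⟨P, hP⟩ := key A k (ind_spec A)
  obtain ⟨Q', hQ'⟩ := key Aᵀ k (by
    rw [← Matrix.transpose_pow, ← Matrix.transpose_pow, Matrix.rank_transpose,
      Matrix.rank_transpose]
    exact ind_spec A)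
  have hQ : A ^ k = Q'ᵀ * A ^ (k + (k + 1)) := by
    have := congrArg Matrix.transpose hQ'
    rwa [Matrix.transpose_mul, ← Matrix.transpose_pow, ← Matrix.transpose_pow,
      Matrix.transpose_transpose, Matrix.transpose_transpose] at this
  set Q := Q'ᵀ
  have hc : A ^ k * P = Q * A ^ k := by
    calc A ^ k * P = Q * A ^ (k + (k + 1)) * P := by rw [← hQ]
      _ = Q * A ^ k := by rw [Matrix.mul_assoc, ← hP]
  have hc' : A * (A ^ k * P) = A ^ k * P * A := by
    calc A * (A ^ k * P) = A * (Q * A ^ (k + (k + 1)) * P) := by rw [← hQ]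
      _ = A * Q * A ^ k := by rw [Matrix.mul_assoc, ← hP, Matrix.mul_assoc]
      _ = A * (A ^ k * P) := by rw [hc, Matrix.mul_assoc]
      _ = A ^ (k + 1) * P := by rw [pow_succ', Matrix.mul_assoc]
      _ = A ^ k * A * P := by rw [pow_succ]
      _ = Q * A ^ (k + (k + 1)) * A * P := by rw [← hQ]
      _ = Q * A * (A ^ (k + (k + 1)) * P) := by
          have : A ^ (k + (k + 1)) * A = A * A ^ (k + (k + 1)) := by rw [← pow_succ, pow_succ']
          rw [Matrix.mul_assoc Q, this]
          simp only [Matrix.mul_assoc]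
      _ = Q * (A * A ^ k) := by rw [← hP, Matrix.mul_assoc]
      _ = Q * A ^ k * A := by rw [← pow_succ', pow_succ, Matrix.mul_assoc]
      _ = A ^ k * P * A := by rw [hc]
  refine ⟨A ^ k * P, ?_, hc', ?_⟩
  · calc A ^ k * P * A * (A ^ k * P) = Q * (A ^ k * A * A ^ k) * P := by
          rw [hc]; nth_rewrite 2 [← hc]; simp only [Matrix.mul_assoc]
      _ = Q * A ^ (k + (k + 1)) * P := by
          rw [← pow_succ, ← pow_add, show k + 1 + k = k + (k + 1) by omega]
      _ = A ^ k * P := by rw [← hQ]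
  · rw [← hkdef, hc, Matrix.mul_assoc, ← pow_add, ← hQ]

theorem IsDrazin.unique {A X Y : Matrix n n ℂ} (hX : IsDrazin A X) (hY : IsDrazin A Y) :
    X = Y := by
  have hidem : ∀ Z : Matrix n n ℂ, IsDrazin A Z →
      A * Z = A ^ (ind A + 1) * Z ^ (ind A + 1) := by
    intro Z hZ
    have hi : IsIdempotentElem (A * Z) := by
      change A * Z * (A * Z) = A * Z
      rw [Matrix.mul_assoc, ← Matrix.mul_assoc Z, hZ.outer]
    rw [← Commute.mul_pow (show Commute A Z from hZ.comm), hi.pow_succ_eq]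
  have hcY : Commute A Y := hY.comm
  have hcX : Commute A X := hX.comm
  have h1 : A * X = A * Y * (A * X) := by
    have e : A * Y * A ^ (ind A + 1) = A ^ (ind A + 1) := by
      rw [Matrix.mul_assoc, hY.pow, ← pow_succ']
    rw [hidem X hX, ← Matrix.mul_assoc, e]
  have h2 : A * Y = A * Y * (A * X) := by
    have e : A ^ (ind A + 1) * (A * X) = A ^ (ind A + 1) := by
      have : A ^ (ind A + 1) * (A * X) = (A * X) * A ^ (ind A + 1) :=
        (((Commute.refl A).mul_right hcX).pow_left _).eq
      rw [this, Matrix.mul_assoc, hX.pow, ← pow_succ']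
    have e' : A * Y = Y ^ (ind A + 1) * A ^ (ind A + 1) := by
      rw [hidem Y hY]; exact (hcY.pow_pow _ _).eq
    rw [e', Matrix.mul_assoc, e]
  have h3 : A * X = A * Y := h1.trans h2.symm
  calc X = X * (A * X) := by rw [← Matrix.mul_assoc, hX.outer]
    _ = (A * X) * Y := by rw [h3, ← Matrix.mul_assoc, ← hX.comm, h3]
    _ = Y := by rw [h3, hY.comm, hY.outer]

/-- The Drazin inverse `A^d`: the unique solution of the three equations. -/
noncomputable def drazinInv (A : Matrix n n ℂ) : Matrix n n ℂ :=
  Classical.choose (exists_isDrazin A)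

theorem drazinInv_spec (A : Matrix n n ℂ) : IsDrazin A (drazinInv A) :=
  Classical.choose_spec (exists_isDrazin A)

/-- The core EP inverse `A^k (A^(k+1))†`, where `k` is the index of `A`. -/
noncomputable def coreEPInv (A : Matrix n n ℂ) : Matrix n n ℂ :=
  A ^ ind A * mpInv (A ^ (ind A + 1))

/-- The weak group (WG) inverse: the square of the core EP inverse, times `A`. -/
noncomputable def wgInv (A : Matrix n n ℂ) : Matrix n n ℂ := coreEPInv A ^ 2 * A

/-- The dual DMP inverse `Q_A A^d`. -/
noncomputable def dualDMPInv (A : Matrix n n ℂ) : Matrix n n ℂ := projQ A * drazinInv A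

/-- The dual WC inverse: `Q_A` times the WG inverse. -/
noncomputable def dualWCInv (A : Matrix n n ℂ) : Matrix n n ℂ := projQ A * wgInv A

/-- WG matrices: `A` commutes with its WG inverse. -/
def IsWG (A : Matrix n n ℂ) : Prop := A * wgInv A = wgInv A * A

/-- Dual `k`-DMP matrices: `A ^ k` commutes with the dual DMP inverse, `k` the index of `A`. -/
def IsDualKDMP (A : Matrix n n ℂ) : Prop :=
  A ^ ind A * dualDMPInv A = dualDMPInv A * A ^ ind A

/-- Dual `k`-WC matrices: `A ^ k` commutes with the dual WC inverse, `k` the index of `A`. -/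
def IsDualKWC (A : Matrix n n ℂ) : Prop :=
  A ^ ind A * dualWCInv A = dualWCInv A * A ^ ind A

end Square

/-- The `n × n` matrix with blocks `[T, S; 0, N]`, where `T` is `t × t`, `N` is `s × s`
and `t + s = n`. -/
def blockUpper {n t s : ℕ} (h : t + s = n) (T : Matrix (Fin t) (Fin t) ℂ)
    (S : Matrix (Fin t) (Fin s) ℂ) (N : Matrix (Fin s) (Fin s) ℂ) : Matrix (Fin n) (Fin n) ℂ :=
  Matrix.reindex (finSumFinEquiv.trans (finCongr h)) (finSumFinEquiv.trans (finCongr h))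
    (Matrix.fromBlocks T S 0 N)

/-- `A = U [T, S; 0, N] Uᴴ` is a core EP decomposition of `A`: `U` is unitary, `T` is nonsingular
of size `t = rk (A ^ k)`, and `N` is nilpotent of index `k`, where `k` is the index of `A`. -/
structure IsCoreEPDecomposition {n t s : ℕ} (h : t + s = n) (A U : Matrix (Fin n) (Fin n) ℂ)
    (T : Matrix (Fin t) (Fin t) ℂ) (S : Matrix (Fin t) (Fin s) ℂ)
    (N : Matrix (Fin s) (Fin s) ℂ) : Prop where
  unitary : U ∈ Matrix.unitaryGroup (Fin n) ℂ
  eq : A = U * blockUpper h T S N * Uᴴ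
  nonsingular : IsUnit T
  rank_eq : t = (A ^ ind A).rank
  nilpotent : IsNilpotent N
  nilpotent_index : nilpotencyClass N = ind A

end GenInv

/-! Write W for the WG inverse, D for the Drazin inverse, Q for `projQ A`, P for the orthogonal
projector `coreProj A` onto the range of A^k. Everything passes through QW = D, which splits into QD
= D and W = D (`dualWCInv_eq_drazinInv_iff`).

If QW commutes with A^m, m ≥ 1, then A^m Q = A^m gives A^m W = Q W A^m, so Q fixes the range of A^m
W. That range contains the range of D, so QD = D; as W = DAW, also QW = W. Thus W itself commutes
with A^m, which forces W = D (`wgInv_eq_drazinInv_of_commute_pow`).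

Both halves then become equations in P, namely APA = PAA and P(1 - Q) = 0. In the decomposition P =
VVᴴ, with V the first column block of U, and they read SN = 0 and S(1 - Q_N) = 0. These are the two
subspace inclusions, and together they are the single matrix equation. -/

namespace GenInv

/-! ### The projector onto the row space -/

section Projector

variable {m n : Type*} [Fintype m] [Fintype n]

theorem mul_projQ (A : Matrix m n ℂ) : A * projQ A = A := by
  rw [projQ, ← Matrix.mul_assoc, (mpInv_spec A).inner]

theorem projQ_conjTranspose (A : Matrix m n ℂ) : (projQ A)ᴴ = projQ A :=
  (mpInv_spec A).herm_right

theorem projQ_mul_self (A : Matrix m n ℂ) : projQ A * projQ A = projQ A := by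
  conv_lhs => enter [1]; rw [projQ]
  rw [Matrix.mul_assoc, mul_projQ, projQ]

theorem projQ_mul_eq_zero {l : Type*} [Fintype l] {A : Matrix m n ℂ} {Y : Matrix n l ℂ}
    (h : A * Y = 0) : projQ A * Y = 0 := by
  rw [projQ, Matrix.mul_assoc, h, Matrix.mul_zero]

end Projector

/-! ### Drazin, core EP and weak group inverses, without coordinates -/

section Square

variable {n : Type*} [Fintype n] [DecidableEq n] (A : Matrix n n ℂ)

theorem drazinInv_mul_pow_succ : drazinInv A * A ^ (ind A + 1) = A ^ ind A :=
  (drazinInv_spec A).pow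

theorem commute_drazinInv : Commute A (drazinInv A) := (drazinInv_spec A).comm

theorem drazinInv_mul_mul_pow_ind : drazinInv A * A * A ^ ind A = A ^ ind A := by
  rw [mul_assoc, ← pow_succ', drazinInv_mul_pow_succ]

theorem isIdempotentElem_mul_drazinInv : IsIdempotentElem (A * drazinInv A) := by
  change A * drazinInv A * (A * drazinInv A) = _
  rw [mul_assoc, ← mul_assoc (drazinInv A), (drazinInv_spec A).outer]

theorem pow_mul_drazinInv_pow {j : ℕ} (hj : j ≠ 0) :
    A ^ j * drazinInv A ^ j = A * drazinInv A := by
  rw [← (commute_drazinInv A).mul_pow, (isIdempotentElem_mul_drazinInv A).pow_eq hj]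

theorem pow_ind_mul_drazinInv_pow : A ^ ind A * drazinInv A ^ (ind A + 1) = drazinInv A := by
  calc A ^ ind A * drazinInv A ^ (ind A + 1)
      = drazinInv A * (A ^ (ind A + 1) * drazinInv A ^ (ind A + 1)) := by
        rw [← mul_assoc, drazinInv_mul_pow_succ]
    _ = drazinInv A := by
        rw [pow_mul_drazinInv_pow A (Nat.succ_ne_zero _), ← mul_assoc, (drazinInv_spec A).outer]

/-- The orthogonal projector onto the range of `A ^ ind A`. -/
noncomputable def coreProj : Matrix n n ℂ := A ^ (ind A + 1) * mpInv (A ^ (ind A + 1))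

theorem mul_coreEPInv : A * coreEPInv A = coreProj A := by
  rw [coreEPInv, coreProj, pow_succ', mul_assoc]

theorem coreProj_conjTranspose : (coreProj A)ᴴ = coreProj A := (mpInv_spec _).herm_left

/-- A^k = A^(k+1) D, so the columns of A^k already lie in the range of A^(k+1), on which the
projector is the identity. -/
theorem coreProj_mul_pow_ind : coreProj A * A ^ ind A = A ^ ind A := by
  have h : A ^ ind A = A ^ (ind A + 1) * drazinInv A := by
    rw [← drazinInv_mul_pow_succ]
    exact ((commute_drazinInv A).pow_left _).eq.symm
  have h' : coreProj A * A ^ (ind A + 1) = A ^ (ind A + 1) := (mpInv_spec _).inner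
  rw [h, ← mul_assoc, h']

theorem coreEPInv_mul_pow_succ : coreEPInv A * A ^ (ind A + 1) = A ^ ind A := by
  have h := (mpInv_spec (A ^ (ind A + 1))).inner
  calc coreEPInv A * A ^ (ind A + 1)
      = drazinInv A * (A ^ (ind A + 1) * mpInv (A ^ (ind A + 1)) * A ^ (ind A + 1)) := by
        rw [coreEPInv, ← drazinInv_mul_pow_succ]; simp only [mul_assoc]
    _ = A ^ ind A := by rw [h, drazinInv_mul_pow_succ]

theorem drazinInv_mul_mul_coreEPInv : drazinInv A * A * coreEPInv A = coreEPInv A := by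
  rw [coreEPInv, ← mul_assoc, drazinInv_mul_mul_pow_ind]

theorem wgInv_mul_pow_succ : wgInv A * A ^ (ind A + 1) = A ^ ind A := by
  calc wgInv A * A ^ (ind A + 1)
      = coreEPInv A * (coreEPInv A * A ^ (ind A + 1)) * A := by
        rw [wgInv, sq, mul_assoc _ A, ← pow_succ', pow_succ _ (ind A + 1)]
        simp only [mul_assoc]
    _ = A ^ ind A := by
        rw [coreEPInv_mul_pow_succ, mul_assoc, ← pow_succ, coreEPInv_mul_pow_succ]

theorem drazinInv_mul_mul_wgInv : drazinInv A * A * wgInv A = wgInv A := by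
  rw [wgInv, sq, ← mul_assoc, ← mul_assoc, drazinInv_mul_mul_coreEPInv]

theorem mul_wgInv : A * wgInv A = coreEPInv A * A := by
  have h : coreProj A * coreEPInv A = coreEPInv A := by
    rw [coreEPInv, ← mul_assoc, coreProj_mul_pow_ind]
  rw [wgInv, sq, ← mul_assoc, ← mul_assoc, mul_coreEPInv, h]

variable {A}

/-- The weak group inverse commutes with a positive power of `A` only if it is the Drazin
inverse. -/
theorem wgInv_eq_drazinInv_of_commute_pow {m : ℕ} (hm : 1 ≤ m)
    (h : A ^ m * wgInv A = wgInv A * A ^ m) : wgInv A = drazinInv A := by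
  -- A multiple of m, so commutation with A^m passes to A^j; also positive and at least the index,
  -- so A^j absorbs the projector AD.
  set j := m * (ind A + 1) with hj
  have hcomm : A ^ j * wgInv A = wgInv A * A ^ j := by
    have h' : Commute (A ^ m) (wgInv A) := h
    rw [hj, pow_mul]
    exact (h'.pow_left _).eq
  have hle : ind A ≤ j := by
    calc ind A ≤ 1 * (ind A + 1) := by omega
      _ ≤ j := Nat.mul_le_mul_right _ hm
  have hj0 : j ≠ 0 := Nat.mul_ne_zero (by omega) (by omega)
  have hE : drazinInv A ^ j * A ^ j = A * drazinInv A := by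
    rw [← pow_mul_drazinInv_pow A hj0, ((commute_drazinInv A).pow_pow j j).eq]
  have hB : A ^ j * (A * drazinInv A) = A ^ j := by
    rw [(((Commute.refl A).mul_right (commute_drazinInv A)).pow_left j).eq,
      (commute_drazinInv A).eq, ← Nat.add_sub_cancel' hle, pow_add, ← mul_assoc,
      drazinInv_mul_mul_pow_ind]
  have hEW : A * drazinInv A * wgInv A = wgInv A := by
    rw [(commute_drazinInv A).eq, drazinInv_mul_mul_wgInv]
  -- Moving A^j to the right of W yields W = W(AD). Rewriting AD as A^(k+1) D^(k+1) then brings in W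
  -- A^(k+1) = A^k.
  calc wgInv A = drazinInv A ^ j * A ^ j * wgInv A := by rw [hE, hEW]
    _ = drazinInv A ^ j * (wgInv A * A ^ j) := by rw [mul_assoc, hcomm]
    _ = drazinInv A ^ j * A ^ j * wgInv A * (A * drazinInv A) := by
        rw [mul_assoc _ (A ^ j), hcomm]; simp only [mul_assoc]; rw [hB]
    _ = wgInv A * (A ^ (ind A + 1) * drazinInv A ^ (ind A + 1)) := by
        rw [hE, hEW, pow_mul_drazinInv_pow A (Nat.succ_ne_zero _)]
    _ = drazinInv A := by
        rw [← mul_assoc, wgInv_mul_pow_succ, pow_ind_mul_drazinInv_pow]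

theorem pow_mul_projQ {m : ℕ} (hm : 1 ≤ m) : A ^ m * projQ A = A ^ m := by
  obtain ⟨m, rfl⟩ := Nat.exists_eq_add_of_le' hm
  rw [pow_succ, mul_assoc, mul_projQ]

/-- Since AQ = A, left multiplication by DA removes Q: DA(QW) = DAW = W, while DAD = D. -/
theorem dualWCInv_eq_drazinInv_iff :
    dualWCInv A = drazinInv A ↔
      projQ A * drazinInv A = drazinInv A ∧ wgInv A = drazinInv A := by
  refine ⟨fun h => ?_, fun ⟨h₁, h₂⟩ => by rw [dualWCInv, h₂, h₁]⟩
  have hW : wgInv A = drazinInv A := by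
    calc wgInv A = drazinInv A * (A * projQ A * wgInv A) := by
          rw [mul_projQ, ← mul_assoc, drazinInv_mul_mul_wgInv]
      _ = drazinInv A * A * dualWCInv A := by rw [dualWCInv]; simp only [mul_assoc]
      _ = drazinInv A := by rw [h, (drazinInv_spec A).outer]
  exact ⟨by rw [← h, dualWCInv, ← mul_assoc, projQ_mul_self], hW⟩

/-- The dual WC inverse commutes with a positive power of `A` only if it is the Drazin inverse. -/
theorem dualWCInv_eq_drazinInv_of_commute_pow {m : ℕ} (hm : 1 ≤ m)
    (h : A ^ m * dualWCInv A = dualWCInv A * A ^ m) : dualWCInv A = drazinInv A := by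
  have h₁ : A ^ m * wgInv A = projQ A * (wgInv A * A ^ m) := by
    rw [dualWCInv, ← mul_assoc, pow_mul_projQ hm, mul_assoc] at h
    exact h
  have hQ : projQ A * (A ^ m * wgInv A) = A ^ m * wgInv A := by
    rw [h₁, ← mul_assoc, projQ_mul_self]
  -- This exhibits D as A^m W times a matrix, so its columns are fixed by Q. The factor A^(k+1)
  -- collapses W to A^k, and the exponent k + m + 1 reduces A^m A^k to D.
  have hpow : A ^ m * wgInv A * (A ^ (ind A + 1) * drazinInv A ^ (ind A + m + 1)) =
      drazinInv A := by
    calc A ^ m * wgInv A * (A ^ (ind A + 1) * drazinInv A ^ (ind A + m + 1))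
        = A ^ m * (wgInv A * A ^ (ind A + 1)) * drazinInv A ^ (ind A + m + 1) := by
          simp only [mul_assoc]
      _ = A ^ ind A * drazinInv A ^ (ind A + 1) * (A ^ m * drazinInv A ^ m) := by
          rw [wgInv_mul_pow_succ, ← pow_add, add_comm m, pow_add,
            show ind A + m + 1 = ind A + 1 + m by omega, pow_add, mul_assoc, mul_assoc,
            ← mul_assoc (A ^ m), ((commute_drazinInv A).pow_pow m (ind A + 1)).eq, mul_assoc]
      _ = drazinInv A := by
          rw [pow_ind_mul_drazinInv_pow, pow_mul_drazinInv_pow A (by omega), ← mul_assoc,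
            (drazinInv_spec A).outer]
  have hD : projQ A * drazinInv A = drazinInv A := by
    rw [← hpow, ← mul_assoc, hQ]
  have hW : projQ A * wgInv A = wgInv A := by
    rw [← drazinInv_mul_mul_wgInv, ← mul_assoc, ← mul_assoc, hD]
  rw [← mul_assoc, hW] at h₁
  rw [dualWCInv, hW, wgInv_eq_drazinInv_of_commute_pow hm h₁]

theorem isWG_iff : IsWG A ↔ wgInv A = drazinInv A := by
  refine ⟨fun h => wgInv_eq_drazinInv_of_commute_pow le_rfl (by rwa [pow_one]), fun h => ?_⟩
  rw [IsWG, h, (drazinInv_spec A).comm]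

theorem isDualKDMP_iff (hk : 1 ≤ ind A) :
    IsDualKDMP A ↔ projQ A * drazinInv A = drazinInv A := by
  have hc : A ^ ind A * drazinInv A = drazinInv A * A ^ ind A :=
    ((commute_drazinInv A).pow_left _).eq
  rw [IsDualKDMP, dualDMPInv, ← mul_assoc, pow_mul_projQ hk, hc]
  refine ⟨fun h => ?_, fun h => by rw [h]⟩
  have hD : drazinInv A * A ^ ind A * drazinInv A ^ ind A = drazinInv A := by
    rw [mul_assoc, pow_mul_drazinInv_pow A (by omega), ← mul_assoc, (drazinInv_spec A).outer]
  rw [← hD, ← mul_assoc, ← mul_assoc, ← h]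

/-- Because A²W = PA, the right-hand equation is AW = WA multiplied on the left by A². The factor A²
cancels against D², as both sides have columns in the range of D. -/
theorem wgInv_eq_drazinInv_iff :
    wgInv A = drazinInv A ↔ A * coreProj A * A = coreProj A * A * A := by
  have h₂ : A * (A * wgInv A) = coreProj A * A := by
    rw [mul_wgInv, ← mul_assoc, mul_coreEPInv]
  have hDDA : drazinInv A * drazinInv A * A = drazinInv A := by
    rw [mul_assoc, ← (drazinInv_spec A).comm, ← mul_assoc, (drazinInv_spec A).outer]
  rw [← isWG_iff, IsWG]
  constructor
  · intro h
    rw [mul_assoc A, ← h₂, mul_assoc A (A * wgInv A), mul_assoc A (wgInv A), h]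
  · intro h
    have hDA : ∀ Y, drazinInv A * drazinInv A * (A * (A * (wgInv A * Y))) = wgInv A * Y := by
      intro Y
      rw [← mul_assoc _ A, hDDA, ← mul_assoc, ← mul_assoc, drazinInv_mul_mul_wgInv]
    have hc : drazinInv A * drazinInv A * A = A * (drazinInv A * drazinInv A) :=
      ((commute_drazinInv A).mul_right (commute_drazinInv A)).eq.symm
    calc A * wgInv A
        = A * (drazinInv A * drazinInv A * (A * (A * (wgInv A * 1)))) := by
          rw [hDA, mul_one]
      _ = drazinInv A * drazinInv A * (A * (A * (A * wgInv A))) := by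
          rw [← mul_assoc, ← hc, mul_one, mul_assoc _ A]
      _ = drazinInv A * drazinInv A * (A * (A * (wgInv A * A))) := by
          rw [h₂, ← mul_assoc A (coreProj A), h, ← h₂]; simp only [mul_assoc]
      _ = wgInv A * A := hDA A

/-- Taking adjoints turns the right-hand side into QP = P. Both conditions say that Q fixes the
range of A^k, which is the range of D and of P. -/
theorem projQ_mul_drazinInv_iff :
    projQ A * drazinInv A = drazinInv A ↔ coreProj A * (1 - projQ A) = 0 := by
  have hstar : coreProj A * (1 - projQ A) = 0 ↔ projQ A * coreProj A = coreProj A := by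
    rw [← Matrix.conjTranspose_eq_zero, Matrix.conjTranspose_mul, Matrix.conjTranspose_sub,
      Matrix.conjTranspose_one, projQ_conjTranspose, coreProj_conjTranspose, sub_mul, one_mul,
      sub_eq_zero, eq_comm]
  rw [hstar]
  constructor <;> intro h
  · have hA : projQ A * A ^ ind A = A ^ ind A := by
      rw [← drazinInv_mul_pow_succ, ← mul_assoc, h]
    rw [coreProj, pow_succ, ← mul_assoc, ← mul_assoc, hA]
  · have hA : projQ A * A ^ ind A = A ^ ind A := by
      rw [← coreProj_mul_pow_ind, ← mul_assoc, h]
    rw [← pow_ind_mul_drazinInv_pow, ← mul_assoc, hA]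

end Square

/-! ### Conditions on the blocks S, N of a core EP decomposition -/

section Decomposition

variable {n p q : Type*} [Fintype n] [DecidableEq n] [Fintype p] [DecidableEq p]
  [Fintype q] [DecidableEq q]

/-- A core EP decomposition in terms of the two column blocks `V`, `W` of the unitary factor. -/
structure IsCoreEPBlocks (A : Matrix n n ℂ) (V : Matrix n p ℂ) (W : Matrix n q ℂ)
    (T : Matrix p p ℂ) (S : Matrix p q ℂ) (N : Matrix q q ℂ) : Prop where
  isometry_left : Vᴴ * V = 1
  isometry_right : Wᴴ * W = 1
  orthogonal : Vᴴ * W = 0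
  resolution : V * Vᴴ + W * Wᴴ = 1
  mul_left : A * V = V * T
  mul_right : A * W = V * S + W * N
  nonsingular : IsUnit T
  nilpotent : N ^ ind A = 0

namespace IsCoreEPBlocks

variable {A : Matrix n n ℂ} {V : Matrix n p ℂ} {W : Matrix n q ℂ}
  {T : Matrix p p ℂ} {S : Matrix p q ℂ} {N : Matrix q q ℂ}

theorem orthogonal' (h : IsCoreEPBlocks A V W T S N) : Wᴴ * V = 0 := by
  rw [← Matrix.conjTranspose_eq_zero, Matrix.conjTranspose_mul,
    Matrix.conjTranspose_conjTranspose, h.orthogonal]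

theorem eq_sum (h : IsCoreEPBlocks A V W T S N) :
    A = V * T * Vᴴ + (V * S + W * N) * Wᴴ := by
  rw [← h.mul_left, ← h.mul_right, Matrix.mul_assoc, Matrix.mul_assoc, ← Matrix.mul_add,
    h.resolution, Matrix.mul_one]

theorem left_mul (h : IsCoreEPBlocks A V W T S N) : Vᴴ * A = T * Vᴴ + S * Wᴴ := by
  conv_lhs => rw [h.eq_sum]
  simp only [Matrix.mul_add, Matrix.add_mul, ← Matrix.mul_assoc, h.isometry_left, h.orthogonal,
    Matrix.one_mul, Matrix.zero_mul, add_zero]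

theorem right_mul (h : IsCoreEPBlocks A V W T S N) : Wᴴ * A = N * Wᴴ := by
  conv_lhs => rw [h.eq_sum]
  simp only [Matrix.mul_add, Matrix.add_mul, ← Matrix.mul_assoc, h.isometry_right, h.orthogonal',
    Matrix.one_mul, Matrix.zero_mul, zero_add]

theorem pow_mul_left (h : IsCoreEPBlocks A V W T S N) (j : ℕ) : A ^ j * V = V * T ^ j := by
  induction j with
  | zero => simp
  | succ j ih =>
    rw [pow_succ, Matrix.mul_assoc, h.mul_left, ← Matrix.mul_assoc, ih, Matrix.mul_assoc,
      ← pow_succ]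

theorem right_mul_pow (h : IsCoreEPBlocks A V W T S N) (j : ℕ) : Wᴴ * A ^ j = N ^ j * Wᴴ := by
  induction j with
  | zero => simp
  | succ j ih =>
    rw [pow_succ, ← Matrix.mul_assoc, ih, Matrix.mul_assoc, h.right_mul, ← Matrix.mul_assoc,
      ← pow_succ]

theorem left_mul_pow_ind (h : IsCoreEPBlocks A V W T S N) :
    V * Vᴴ * A ^ ind A = A ^ ind A := by
  have hW : Wᴴ * A ^ ind A = 0 := by rw [h.right_mul_pow, h.nilpotent, Matrix.zero_mul]
  calc V * Vᴴ * A ^ ind A = (V * Vᴴ + W * Wᴴ) * A ^ ind A := by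
        rw [Matrix.add_mul, Matrix.mul_assoc W, hW, Matrix.mul_zero, add_zero]
    _ = A ^ ind A := by rw [h.resolution, Matrix.one_mul]

/-- Two Hermitian projectors with the same range: VVᴴ fixes A^k because N^k = 0, and P fixes V
because A^k V = V T^k with T^k invertible. -/
theorem coreProj_eq (h : IsCoreEPBlocks A V W T S N) : coreProj A = V * Vᴴ := by
  have hl : V * Vᴴ * coreProj A = coreProj A := by
    rw [coreProj, pow_succ]
    simp only [← Matrix.mul_assoc]
    rw [h.left_mul_pow_ind]
  have hV : coreProj A * V = V := by
    obtain ⟨R, hR, -⟩ := isUnit_iff_exists.mp (h.nonsingular.pow (ind A))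
    calc coreProj A * V = coreProj A * (A ^ ind A * V) * R := by
          rw [h.pow_mul_left, Matrix.mul_assoc, Matrix.mul_assoc, hR, Matrix.mul_one]
      _ = V := by
          rw [← Matrix.mul_assoc, coreProj_mul_pow_ind, h.pow_mul_left, Matrix.mul_assoc, hR,
            Matrix.mul_one]
  have hs := congrArg Matrix.conjTranspose hl
  rw [Matrix.conjTranspose_mul, Matrix.conjTranspose_mul, Matrix.conjTranspose_conjTranspose,
    coreProj_conjTranspose, ← Matrix.mul_assoc, hV] at hs
  exact hs.symm

/-- PAA - APA equals V(SN)Wᴴ, and the isometries V and W can be stripped off. -/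
theorem wgInv_eq_drazinInv_iff (h : IsCoreEPBlocks A V W T S N) :
    wgInv A = drazinInv A ↔ S * N = 0 := by
  have hAP : A * (V * Vᴴ) * A = V * T * (Vᴴ * A) := by
    rw [← Matrix.mul_assoc, h.mul_left, Matrix.mul_assoc]
  have hPA : V * Vᴴ * A * A = V * T * (Vᴴ * A) + V * (S * N) * Wᴴ := by
    rw [Matrix.mul_assoc V, h.left_mul, Matrix.mul_assoc V, Matrix.add_mul,
      Matrix.mul_assoc S, h.right_mul, Matrix.mul_assoc T, h.left_mul, Matrix.mul_add]
    simp only [Matrix.mul_assoc]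
  rw [GenInv.wgInv_eq_drazinInv_iff, h.coreProj_eq, hAP, hPA, left_eq_add]
  refine ⟨fun h0 => ?_, fun h0 => by rw [h0, Matrix.mul_zero, Matrix.zero_mul]⟩
  calc S * N = Vᴴ * V * (S * N) * (Wᴴ * W) := by
        rw [h.isometry_left, h.isometry_right, Matrix.one_mul, Matrix.mul_one]
    _ = Vᴴ * (V * (S * N) * Wᴴ) * W := by simp only [Matrix.mul_assoc]
    _ = 0 := by rw [h0, Matrix.mul_zero, Matrix.zero_mul]

/-- The left side says that Vᴴ vanishes on the null space of A. That space consists of the vectors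
Wz - V T⁻¹Sz with Nz = 0, on which Vᴴ takes the value -T⁻¹Sz. -/
theorem projQ_mul_drazinInv_iff (h : IsCoreEPBlocks A V W T S N) :
    projQ A * drazinInv A = drazinInv A ↔ S * (1 - projQ N) = 0 := by
  rw [GenInv.projQ_mul_drazinInv_iff, h.coreProj_eq]
  obtain ⟨R, hR, hR'⟩ := isUnit_iff_exists.mp h.nonsingular
  constructor
  · intro h0
    have hV : Vᴴ * (1 - projQ A) = 0 := by
      calc Vᴴ * (1 - projQ A) = Vᴴ * V * Vᴴ * (1 - projQ A) := by
            rw [h.isometry_left, Matrix.one_mul]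
        _ = Vᴴ * (V * Vᴴ * (1 - projQ A)) := by simp only [Matrix.mul_assoc]
        _ = 0 := by rw [h0, Matrix.mul_zero]
    set Z := 1 - projQ N with hZ
    have hNZ : N * Z = 0 := by rw [hZ, Matrix.mul_sub, Matrix.mul_one, mul_projQ, sub_self]
    -- The columns of Z lie in the null space of N; the correction by V R S Z, with R = T⁻¹, lifts
    -- them to the null space of A.
    have hY : A * (W * Z - V * (R * (S * Z))) = 0 := by
      rw [Matrix.mul_sub, ← Matrix.mul_assoc, ← Matrix.mul_assoc, h.mul_left, h.mul_right,
        Matrix.add_mul, Matrix.mul_assoc W, hNZ, Matrix.mul_zero, add_zero, Matrix.mul_assoc V T,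
        ← Matrix.mul_assoc T, hR, Matrix.one_mul, Matrix.mul_assoc, sub_self]
    have hY' : (1 - projQ A) * (W * Z - V * (R * (S * Z))) = W * Z - V * (R * (S * Z)) := by
      rw [Matrix.sub_mul, projQ_mul_eq_zero hY, Matrix.one_mul, sub_zero]
    have hRS : R * (S * Z) = 0 := by
      have h1 : Vᴴ * (W * Z - V * (R * (S * Z))) = 0 := by
        rw [← hY', ← Matrix.mul_assoc, hV, Matrix.zero_mul]
      rw [Matrix.mul_sub, ← Matrix.mul_assoc, ← Matrix.mul_assoc, h.orthogonal, h.isometry_left,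
        Matrix.zero_mul, Matrix.one_mul, zero_sub, neg_eq_zero] at h1
      exact h1
    rw [← Matrix.one_mul S, ← hR, Matrix.mul_assoc T, Matrix.mul_assoc T, Matrix.mul_assoc R,
      hRS, Matrix.mul_zero]
  · intro h0
    set Z := 1 - projQ A with hZ
    have hAZ : A * Z = 0 := by rw [hZ, Matrix.mul_sub, Matrix.mul_one, mul_projQ, sub_self]
    -- Conversely, the W-component of a null vector of A is a null vector of N, so S kills it; the
    -- top block row then leaves T Vᴴ Z = 0.
    have hN : N * (Wᴴ * Z) = 0 := by
      rw [← Matrix.mul_assoc, ← h.right_mul, Matrix.mul_assoc, hAZ, Matrix.mul_zero]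
    have hSW : S * (Wᴴ * Z) = 0 := by
      have h1 : (1 - projQ N) * (Wᴴ * Z) = Wᴴ * Z := by
        rw [Matrix.sub_mul, Matrix.one_mul, projQ_mul_eq_zero hN, sub_zero]
      rw [← h1, ← Matrix.mul_assoc, h0, Matrix.zero_mul]
    have hTV : T * (Vᴴ * Z) = 0 := by
      have h1 : Vᴴ * A * Z = 0 := by rw [Matrix.mul_assoc, hAZ, Matrix.mul_zero]
      rwa [h.left_mul, Matrix.add_mul, Matrix.mul_assoc, Matrix.mul_assoc, hSW, add_zero] at h1
    have hVZ : Vᴴ * Z = 0 := by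
      rw [← Matrix.one_mul (Vᴴ * Z), ← hR', Matrix.mul_assoc, hTV, Matrix.mul_zero]
    rw [Matrix.mul_assoc, hVZ, Matrix.mul_zero]

theorem dualWCInv_eq_drazinInv_iff (h : IsCoreEPBlocks A V W T S N) :
    dualWCInv A = drazinInv A ↔ S * N = 0 ∧ S * (1 - projQ N) = 0 := by
  rw [GenInv.dualWCInv_eq_drazinInv_iff, h.wgInv_eq_drazinInv_iff, h.projQ_mul_drazinInv_iff,
    and_comm]

end IsCoreEPBlocks

/-- Right multiplication by Q_N separates the sum: it fixes SN and annihilates the other term. -/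
theorem mul_add_mul_mul_eq_zero_iff {T : Matrix p p ℂ} (hT : IsUnit T) (S : Matrix p q ℂ)
    (N : Matrix q q ℂ) :
    S * N + T * S * (1 - projQ N) = 0 ↔ S * N = 0 ∧ S * (1 - projQ N) = 0 := by
  refine ⟨fun h => ?_, fun ⟨h₁, h₂⟩ => by
    rw [h₁, Matrix.mul_assoc, h₂, Matrix.mul_zero, add_zero]⟩
  have hSN : S * N = 0 := by
    have h' := congrArg (· * projQ N) h
    simp only [Matrix.add_mul, Matrix.mul_assoc, mul_projQ, Matrix.sub_mul, Matrix.one_mul,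
      projQ_mul_self, sub_self, Matrix.mul_zero, add_zero, Matrix.zero_mul] at h'
    exact h'
  obtain ⟨R, -, hR⟩ := isUnit_iff_exists.mp hT
  rw [hSN, zero_add, Matrix.mul_assoc] at h
  refine ⟨hSN, ?_⟩
  rw [← Matrix.one_mul (S * _), ← hR, Matrix.mul_assoc, h, Matrix.mul_zero]

theorem range_le_ker_mulVecLin_iff {r : Type*} (S : Matrix r q ℂ) (N : Matrix q q ℂ) :
    LinearMap.range N.mulVecLin ≤ LinearMap.ker S.mulVecLin ↔ S * N = 0 := by
  rw [LinearMap.range_le_ker_iff, ← Matrix.mulVecLin_mul]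
  refine ⟨fun h => ?_, fun h => by rw [h, Matrix.mulVecLin_zero]⟩
  exact Matrix.toLin'.injective (h.trans Matrix.mulVecLin_zero.symm)

/-- 1 - Q_N projects onto the null space of N: N annihilates its columns, and it fixes each x with
Nx = 0. -/
theorem ker_le_ker_mulVecLin_iff {r : Type*} (S : Matrix r q ℂ) (N : Matrix q q ℂ) :
    LinearMap.ker N.mulVecLin ≤ LinearMap.ker S.mulVecLin ↔ S * (1 - projQ N) = 0 := by
  constructor
  · intro h
    rw [← range_le_ker_mulVecLin_iff]
    refine le_trans ?_ h
    rw [range_le_ker_mulVecLin_iff, Matrix.mul_sub, Matrix.mul_one, mul_projQ, sub_self]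
  · intro h x hx
    rw [LinearMap.mem_ker, Matrix.mulVecLin_apply] at hx ⊢
    have h' := congrArg (·.mulVec x) h
    simpa [projQ, Matrix.mul_sub, Matrix.sub_mulVec, ← Matrix.mulVec_mulVec, hx] using h'

end Decomposition

theorem IsCoreEPDecomposition.isCoreEPBlocks {n t s : ℕ} {h : t + s = n}
    {A U : Matrix (Fin n) (Fin n) ℂ} {T : Matrix (Fin t) (Fin t) ℂ}
    {S : Matrix (Fin t) (Fin s) ℂ} {N : Matrix (Fin s) (Fin s) ℂ}
    (hd : IsCoreEPDecomposition h A U T S N) :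
    IsCoreEPBlocks A (U.submatrix id (finSumFinEquiv.trans (finCongr h) ∘ Sum.inl))
      (U.submatrix id (finSumFinEquiv.trans (finCongr h) ∘ Sum.inr)) T S N := by
  set e := finSumFinEquiv.trans (finCongr h) with he
  have hU : Uᴴ * U = 1 := Matrix.mem_unitaryGroup_iff'.mp hd.unitary
  have hU' : U * Uᴴ = 1 := Matrix.mem_unitaryGroup_iff.mp hd.unitary
  have hsub : ∀ {α β : Type} (f : α → Fin n) (g : β → Fin n),
      (U.submatrix id f)ᴴ * U.submatrix id g = (1 : Matrix (Fin n) (Fin n) ℂ).submatrix f g := by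
    intro α β f g
    rw [← hU]
    rfl
  have hAU : A * U = U * blockUpper h T S N := by
    conv_lhs => rw [hd.eq]
    rw [Matrix.mul_assoc, hU, Matrix.mul_one]
  -- Block form of AU = U[T, S; 0, N]: the sum over `Fin n` splits along `e` into the two column
  -- blocks.
  have hcol : ∀ {α : Type} (f : α → Fin n), A * U.submatrix id f =
      U.submatrix id (e ∘ Sum.inl) * (blockUpper h T S N).submatrix (e ∘ Sum.inl) f +
      U.submatrix id (e ∘ Sum.inr) * (blockUpper h T S N).submatrix (e ∘ Sum.inr) f := by
    intro α f
    have h1 : A * U.submatrix id f = (U * blockUpper h T S N).submatrix id f := by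
      rw [← hAU]; rfl
    rw [h1]
    ext i j
    simp only [Matrix.submatrix_apply, Matrix.mul_apply, Matrix.add_apply, id, Function.comp]
    rw [← e.sum_comp, Fintype.sum_sum_type]
  refine ⟨?_, ?_, ?_, ?_, ?_, ?_, hd.nonsingular, ?_⟩
  · rw [hsub]
    exact Matrix.submatrix_one _ (e.injective.comp Sum.inl_injective)
  · rw [hsub]
    exact Matrix.submatrix_one _ (e.injective.comp Sum.inr_injective)
  · rw [hsub]
    ext i j
    simp
  · rw [← hU']
    ext i j
    simp only [Matrix.submatrix_apply, Matrix.mul_apply, Matrix.add_apply, id, Function.comp,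
      Matrix.conjTranspose_apply]
    rw [← e.sum_comp, Fintype.sum_sum_type]
  · rw [hcol]
    have h1 : (blockUpper h T S N).submatrix (e ∘ Sum.inl) (e ∘ Sum.inl) = T := by
      ext i j; simp [blockUpper, ← he]
    have h2 : (blockUpper h T S N).submatrix (e ∘ Sum.inr) (e ∘ Sum.inl) = 0 := by
      ext i j; simp [blockUpper, ← he]
    rw [h1, h2, Matrix.mul_zero, add_zero]
  · rw [hcol]
    have h1 : (blockUpper h T S N).submatrix (e ∘ Sum.inl) (e ∘ Sum.inr) = S := by
      ext i j; simp [blockUpper, ← he]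
    have h2 : (blockUpper h T S N).submatrix (e ∘ Sum.inr) (e ∘ Sum.inr) = N := by
      ext i j; simp [blockUpper, ← he]
    rw [h1, h2]
  · rw [← hd.nilpotent_index]
    exact pow_nilpotencyClass hd.nilpotent

end GenInv

/-! ### The equivalences -/

theorem theorem4p6 {n t s : ℕ} (hn : t + s = n)
    (A U : Matrix (Fin n) (Fin n) ℂ) (T : Matrix (Fin t) (Fin t) ℂ)
    (S : Matrix (Fin t) (Fin s) ℂ) (N : Matrix (Fin s) (Fin s) ℂ)
    (hk : 1 ≤ GenInv.ind A)
    (hdec : GenInv.IsCoreEPDecomposition hn A U T S N) :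
    List.TFAE [
      GenInv.IsDualKWC A,
      ∀ m : ℕ, 1 ≤ m → A ^ m * GenInv.dualWCInv A = GenInv.dualWCInv A * A ^ m,
      ∃ m : ℕ, 1 ≤ m ∧ A ^ m * GenInv.dualWCInv A = GenInv.dualWCInv A * A ^ m,
      GenInv.dualWCInv A = GenInv.drazinInv A,
      GenInv.IsWG A ∧ GenInv.IsDualKDMP A,
      LinearMap.range N.mulVecLin ≤ LinearMap.ker S.mulVecLin ∧
        LinearMap.ker N.mulVecLin ≤ LinearMap.ker S.mulVecLin,
      S * N + T * S * (1 - GenInv.projQ N) = 0] := by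
  have hb := hdec.isCoreEPBlocks
  have hfg := GenInv.mul_add_mul_mul_eq_zero_iff hdec.nonsingular S N
  -- Positivity of the index makes m = k an admissible exponent, here and in the next implication.
  tfae_have 2 → 1 := fun h => h _ hk
  tfae_have 1 → 3 := fun h => ⟨_, hk, h⟩
  tfae_have 3 → 4 := fun ⟨_, hm, h⟩ => GenInv.dualWCInv_eq_drazinInv_of_commute_pow hm h
  tfae_have 4 → 2 := fun h m _ => by
    rw [h]; exact ((GenInv.commute_drazinInv A).pow_left m).eq
  tfae_have 4 ↔ 5 := by
    rw [GenInv.dualWCInv_eq_drazinInv_iff, GenInv.isWG_iff, GenInv.isDualKDMP_iff hk, and_comm]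
  tfae_have 4 ↔ 6 := by
    rw [hb.dualWCInv_eq_drazinInv_iff, GenInv.range_le_ker_mulVecLin_iff,
      GenInv.ker_le_ker_mulVecLin_iff]
  tfae_have 4 ↔ 7 := by
    rw [hb.dualWCInv_eq_drazinInv_iff, hfg]
  tfae_finish
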